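/- Theorem (Homotopy invariance of de Rham cohomology). Let $X$ and $X'$ be diffeological spaces, and let $C^\infty(X',X)$ be the set of smooth maps $X' \to X$ with the functional diffeology, in which a parametrization $r \mapsto f_r$ on $U$ is a plot if and only if $(r,x') \mapsto f_r(x')$ is smooth on $U \times X'$. Let $t \mapsto f_t$ be a smooth path in $C^\infty(X',X)$, i.e. a smooth map $\mathbf{R} \to C^\infty(X',X)$. Here a differential $k$-form $\alpha \in \Omega^k(X)$ assigns to each plot $P$ of $X$ a smooth $k$-form $\alpha(P)$ on the domain of $P$ such that $\alpha(P\circ F) = F^*(\alpha(P))$ for every smooth parametrization $F$ in that domain; the exterior derivative is $(d\alpha)(P) = d(\alpha(P))$, and the pullback by a smooth map $f$ is $f^*(\alpha)(P) = \alpha(f\circ P)$. Then for every $k \geq 0$ and every closed form $\alpha \in \Omega^k(X)$, the forms $f_1^*\alpha$ and $f_0^*\alpha$ are cohomologous: both are closed, and $f_1^*\alpha - f_0^*\alpha = d\beta$ for some $\beta \in \Omega^{k-1}(X')$. (For $k = 0$, where $\Omega^{-1}(X') = 0$, this means $f_1^*\alpha = f_0^*\alpha$.) -/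

import Mathlib

open scoped ContDiff

namespace Diffeology

section SmoothMaps

variable {X Y : Type*} [DiffeologicalSpace X] [DiffeologicalSpace Y]

/-- The product diffeology on `X × Y`: a map `ℝⁿ → X × Y` is a plot iff both of its components
are plots. -/
instance instProd : DiffeologicalSpace (X × Y) where
  plots n := {p | IsPlot (fun r : EuclideanSpace ℝ (Fin n) ↦ (p r).1) ∧ IsPlot (fun r ↦ (p r).2)}
  constant_plots _ := ⟨isPlot_const, isPlot_const⟩
  plot_reparam hp hf := ⟨isPlot_reparam hp.1 hf, isPlot_reparam hp.2 hf⟩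
  locality {n p} h := by
    constructor
    · refine DiffeologicalSpace.locality fun x ↦ ?_
      obtain ⟨u, hu, hxu, h'⟩ := h x
      exact ⟨u, hu, hxu, fun hfu hf ↦ (h' hfu hf).1⟩
    · refine DiffeologicalSpace.locality fun x ↦ ?_
      obtain ⟨u, hu, hxu, h'⟩ := h x
      exact ⟨u, hu, hxu, fun hfu hf ↦ (h' hfu hf).2⟩

variable (X Y) in
/-- The set `C^∞(X, Y)` of smooth maps between two diffeological spaces. -/
structure SmoothMap where
  /-- The underlying function. -/
  toFun : X → Y
  smooth : DSmooth toFun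

instance : CoeFun (SmoothMap X Y) fun _ ↦ X → Y := ⟨SmoothMap.toFun⟩

/-- The functional diffeology on `C^∞(X, Y)`: a parametrization `r ↦ f_r` is a plot iff
`(r, x) ↦ f_r(x)` is smooth for the product diffeology. -/
instance instSmoothMap : DiffeologicalSpace (SmoothMap X Y) where
  plots n := {p | DSmooth (fun a : EuclideanSpace ℝ (Fin n) × X ↦ p a.1 a.2)}
  constant_plots f := fun n q hq ↦ f.smooth n _ hq.2
  plot_reparam {n m p f} hp hf := fun l q hq ↦
    hp l (fun s ↦ (f (q s).1, (q s).2)) ⟨(hf.comp hq.1.contDiff).isPlot, hq.2⟩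
  locality {n p} h := by
    intro l q hq
    have hq1 : ContDiff ℝ ∞ (fun s ↦ (q s).1) := hq.1.contDiff
    refine DiffeologicalSpace.locality fun s ↦ ?_
    obtain ⟨u, hu, hxu, h'⟩ := h (q s).1
    refine ⟨(fun s ↦ (q s).1) ⁻¹' u, hu.preimage hq1.continuous, hxu, fun {m f} hfu hf ↦ ?_⟩
    exact h' (f := fun s ↦ (q (f s)).1) hfu (hq1.comp hf) m (fun s ↦ (s, (q (f s)).2))
      ⟨isPlot_id', isPlot_reparam hq.2 hf⟩

end SmoothMaps

section Forms

variable (X : Type*) [DiffeologicalSpace X]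

/-- The condition that a family of `k`-forms on the domains of the plots of `X` is a differential
`k`-form on `X`: each `α(p)` is smooth, and `α(p ∘ F) = F^*(α(p))` for all smooth
`F : ℝᵐ → ℝⁿ`. -/
structure IsDForm {k : ℕ} (α : (n : ℕ) → {p : EuclideanSpace ℝ (Fin n) → X // IsPlot p} →
    EuclideanSpace ℝ (Fin n) → EuclideanSpace ℝ (Fin n) [⋀^Fin k]→L[ℝ] ℝ) : Prop where
  contDiff (n : ℕ) (p : {p : EuclideanSpace ℝ (Fin n) → X // IsPlot p}) : ContDiff ℝ ∞ (α n p)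
  comp (m n : ℕ) (p : {p : EuclideanSpace ℝ (Fin n) → X // IsPlot p})
    (F : EuclideanSpace ℝ (Fin m) → EuclideanSpace ℝ (Fin n)) (hF : ContDiff ℝ ∞ F)
    (x : EuclideanSpace ℝ (Fin m)) :
    α m ⟨p.1 ∘ F, isPlot_reparam p.2 hF⟩ x =
      (α n p (F x)).compContinuousLinearMap (fderiv ℝ F x)

/-- The real vector space `Ω^k(X)` of differential `k`-forms on a diffeological space `X`: a form
assigns to each plot `p : ℝⁿ → X` a smooth `k`-form on `ℝⁿ`, compatibly with smooth
reparametrizations. The vector space operations are plotwise. -/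
def DForm (k : ℕ) : Submodule ℝ ((n : ℕ) → {p : EuclideanSpace ℝ (Fin n) → X // IsPlot p} →
    EuclideanSpace ℝ (Fin n) → EuclideanSpace ℝ (Fin n) [⋀^Fin k]→L[ℝ] ℝ) where
  carrier := {α | IsDForm X α}
  zero_mem' := ⟨fun _ _ ↦ contDiff_const, fun _ _ _ _ _ _ ↦ by ext; simp⟩
  add_mem' {a b} ha hb := ⟨fun n p ↦ (ha.contDiff n p).add (hb.contDiff n p),
    fun m n p F hF x ↦ by
      have h1 := ha.comp m n p F hF x
      have h2 := hb.comp m n p F hF x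
      ext v
      simp [h1, h2]⟩
  smul_mem' c {a} ha := ⟨fun n p ↦ (ha.contDiff n p).const_smul c, fun m n p F hF x ↦ by
    have h1 := ha.comp m n p F hF x
    ext v
    simp [h1]⟩

variable {X}

theorem isDForm_val {k : ℕ} (α : DForm X k) : IsDForm X α.1 := α.2

/-- The exterior derivative `d : Ω^k(X) → Ω^{k+1}(X)`, `(dα)(p) = d(α(p))`. -/
noncomputable def extD (k : ℕ) : DForm X k →ₗ[ℝ] DForm X (k + 1) where
  toFun α := ⟨fun n p ↦ extDeriv (α.1 n p), by
    refine IsDForm.mk (fun n p ↦ ?_) (fun m n p F hF x ↦ ?_)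
    · exact (ContinuousLinearMap.contDiff (𝕜 := ℝ)
        (ContinuousAlternatingMap.alternatizeUncurryFinCLM ℝ (EuclideanSpace ℝ (Fin n)) ℝ)).comp
        (((isDForm_val α).contDiff n p).fderiv_right (m := ∞) (by simp))
    · have h : α.1 m ⟨p.1 ∘ F, isPlot_reparam p.2 hF⟩ = fun y ↦
          (α.1 n p (F y)).compContinuousLinearMap (fderiv ℝ F y) :=
        funext ((isDForm_val α).comp m n p F hF)
      simp only [h]
      exact extDeriv_pullback (((isDForm_val α).contDiff n p).differentiable (by simp) _)
        hF.contDiffAt (by simpa using WithTop.coe_le_coe.2 (le_top : (2 : ℕ∞) ≤ ⊤))⟩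
  map_add' a b := by
    ext n p x : 4
    exact extDeriv_add (((isDForm_val a).contDiff n p).differentiable (by simp) _)
      (((isDForm_val b).contDiff n p).differentiable (by simp) _)
  map_smul' c a := by
    ext n p x : 4
    exact extDeriv_smul c _

/-- The pullback `f^*(α)(p) = α(f ∘ p)` of a differential form by a smooth map. -/
def SmoothMap.pullback {X' : Type*} [DiffeologicalSpace X'] (f : SmoothMap X' X) {k : ℕ}
    (α : DForm X k) : DForm X' k :=
  ⟨fun n p ↦ α.1 n ⟨f ∘ p.1, f.smooth n p.1 p.2⟩,
    IsDForm.mk (fun _ _ ↦ (isDForm_val α).contDiff _ _) fun m n p F hF x ↦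
      (isDForm_val α).comp m n ⟨f ∘ p.1, f.smooth n p.1 p.2⟩ F hF x⟩

variable (X)

/-- The space `Z^k(X)` of closed `k`-forms, `dα = 0`. -/
noncomputable def closedForms (k : ℕ) : Submodule ℝ (DForm X k) := LinearMap.ker (extD k)

/-- The space `B^k(X)` of exact `k`-forms, `α = dβ` with `β` a `(k-1)`-form. There are no nonzero
forms of negative degree, so the only exact `0`-form is `0`. -/
noncomputable def exactForms : (k : ℕ) → Submodule ℝ (DForm X k)
  | 0 => ⊥
  | k + 1 => LinearMap.range (extD k)

variable {X}

/-- Two forms are cohomologous if they are closed and define the same class in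
`H^k(X) = Z^k(X) / B^k(X)`, i.e. their difference is exact. -/
def Cohomologous {k : ℕ} (α β : DForm X k) : Prop :=
  α ∈ closedForms X k ∧ β ∈ closedForms X k ∧ α - β ∈ exactForms X k

end Forms

end Diffeology

open Diffeology

/-! For a plot `p` of `X'`, the map `(t, r) ↦ f_t (p r)` is a plot of `X`, so `α` gives an ordinary
closed form `η` on `ℝ × ℝⁿ` whose slice at time `t` is `(f_t^*α)(p)` (`cylinderForm_restrict`). Let
`K η` be the integral over `t ∈ [0, 1]` of the contraction of `η` with `∂/∂t`. By Cartan's formula,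
`dη = 0` makes `∂η/∂t` on spatial vectors the exterior derivative of that contraction; integrating
in `t` gives `d(K η) = η|₁ - η|₀` (`extDeriv_fiberIntegral`). Reparametrizing `p` by `F` pulls `η`
back along `id × F` (`cylinderForm_comp`), which preserves `t` and `∂/∂t`. So the forms `K η` are
compatible and define the primitive on `X'`. In degree `0`, closedness says that `η` is constant in
`t`. -/

open MeasureTheory intervalIntegral Set Filter Topology

namespace Diffeology

/-! ### Smooth dependence of integrals on parameters -/

section ParametricIntegral

universe u

variable {E G : Type u} [NormedAddCommGroup E] [NormedSpace ℝ E] [NormedAddCommGroup G]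
  [NormedSpace ℝ G]

/-- Differentiation under the integral sign for `C¹` integrands on a compact interval. -/
theorem hasFDerivAt_intervalIntegral_of_contDiff {g : ℝ × E → G} (hg : ContDiff ℝ 1 g)
    (a b : ℝ) (x₀ : E) :
    HasFDerivAt (fun x ↦ ∫ t in a..b, g (t, x))
      (∫ t in a..b, (fderiv ℝ g (t, x₀)).comp (ContinuousLinearMap.inr ℝ ℝ E)) x₀ := by
  have hg' : Continuous fun q : ℝ × E ↦
      (fderiv ℝ g q).comp (ContinuousLinearMap.inr ℝ ℝ E) :=
    (hg.continuous_fderiv one_ne_zero).clm_comp continuous_const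
  obtain ⟨C, hC⟩ := (isCompact_uIcc (a := a) (b := b)).exists_bound_of_continuousOn
    (f := fun t ↦ (fderiv ℝ g (t, x₀)).comp (ContinuousLinearMap.inr ℝ ℝ E))
    (hg'.comp (by fun_prop : Continuous fun t : ℝ ↦ (t, x₀))).continuousOn
  -- One neighbourhood of `x₀` must serve all `t`: the bound `C` at `x₀` gives the open condition `<
  -- C + 1`, and compactness of the interval makes it uniform in `t`.
  have hs : ∀ᶠ x in 𝓝 x₀, ∀ t ∈ uIcc a b,
      ‖(fderiv ℝ g (t, x)).comp (ContinuousLinearMap.inr ℝ ℝ E)‖ < C + 1 := by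
    refine isCompact_uIcc.eventually_forall_of_forall_eventually fun t ht ↦ ?_
    have hc : Continuous fun z : E × ℝ ↦
        ‖(fderiv ℝ g (z.2, z.1)).comp (ContinuousLinearMap.inr ℝ ℝ E)‖ :=
      (hg'.comp continuous_swap).norm
    exact hc.continuousAt.eventually_lt_const (lt_of_le_of_lt (hC t ht) (lt_add_one C))
  have hcont (x : E) : Continuous fun t : ℝ ↦ g (t, x) := hg.continuous.comp (by fun_prop)
  refine hasFDerivAt_integral_of_dominated_of_fderiv_le (bound := fun _ ↦ C + 1)
    (F' := fun x t ↦ (fderiv ℝ g (t, x)).comp (ContinuousLinearMap.inr ℝ ℝ E)) hs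
    (.of_forall fun x ↦ (hcont x).aestronglyMeasurable)
    ((hcont x₀).intervalIntegrable a b)
    (hg'.comp (by fun_prop : Continuous fun t : ℝ ↦ (t, x₀))).aestronglyMeasurable
    (.of_forall fun t ht x hx ↦ (hx t (uIoc_subset_uIcc ht)).le)
    (by simp)
    (.of_forall fun t _ x _ ↦ ?_)
  exact ((hg.differentiable one_ne_zero) (t, x)).hasFDerivAt.comp x
    (hasFDerivAt_prodMk_right t x)

theorem fderiv_intervalIntegral_apply {g : ℝ × E → G} (hg : ContDiff ℝ 1 g)
    (a b : ℝ) (x v : E) :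
    fderiv ℝ (fun x ↦ ∫ t in a..b, g (t, x)) x v =
      ∫ t in a..b, fderiv ℝ g (t, x) (0, v) := by
  rw [(hasFDerivAt_intervalIntegral_of_contDiff hg a b x).fderiv]
  have hc : Continuous fun t : ℝ ↦
      (fderiv ℝ g (t, x)).comp (ContinuousLinearMap.inr ℝ ℝ E) :=
    ((hg.continuous_fderiv one_ne_zero).comp
      (by fun_prop : Continuous fun t : ℝ ↦ (t, x))).clm_comp continuous_const
  exact ContinuousLinearMap.intervalIntegral_apply (hc.intervalIntegrable a b) v

/-- The integral over a compact interval of a smooth function depends smoothly on parameters. -/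
theorem contDiff_intervalIntegral {g : ℝ × E → G} (hg : ContDiff ℝ ∞ g) (a b : ℝ) :
    ContDiff ℝ ∞ fun x ↦ ∫ t in a..b, g (t, x) := by
  refine contDiff_infty.2 fun n ↦ ?_
  -- The derivative is again such an integral, with values in `E →L[ℝ] G`; hence `G` varies, and `E`
  -- and `G` share a universe.
  induction n generalizing G with
  | zero =>
    exact contDiff_zero.2 (continuous_iff_continuousAt.2 fun x ↦
      (hasFDerivAt_intervalIntegral_of_contDiff (hg.of_le (by simp)) a b x).continuousAt)
  | succ n ih =>
    have h := hasFDerivAt_intervalIntegral_of_contDiff (hg.of_le (by simp)) a b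
    refine (contDiff_succ_iff_hasFDerivAt (n := n)).2 ⟨_, ?_, h⟩
    exact ih ((hg.fderiv_right (m := ∞) (by simp)).clm_comp contDiff_const)

end ParametricIntegral

/-! ### Integration along the fibers and the homotopy formula -/

section FiberIntegral

variable {E : Type} [NormedAddCommGroup E] [NormedSpace ℝ E] {k : ℕ}

variable (E k) in
/-- Contraction of a form on `ℝ × E` with `∂/∂t`, restricted to `E`. -/
noncomputable def contractTime :
    (ℝ × E) [⋀^Fin (k + 1)]→L[ℝ] ℝ →L[ℝ] E [⋀^Fin k]→L[ℝ] ℝ :=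
  (ContinuousAlternatingMap.compContinuousLinearMapCLM (ContinuousLinearMap.inr ℝ ℝ E)).comp
    ((ContinuousLinearMap.apply ℝ _ ((1, 0) : ℝ × E)).comp
      (ContinuousAlternatingMap.curryLeftLI (𝕜 := ℝ)).toContinuousLinearMap)

theorem contractTime_apply (η : (ℝ × E) [⋀^Fin (k + 1)]→L[ℝ] ℝ) (v : Fin k → E) :
    contractTime E k η v = η (Fin.cons (1, 0) fun i ↦ (0, v i)) := rfl

/-- Integration along the fibers of `[0, 1] × E → E`. -/
noncomputable def fiberIntegral (η : ℝ × E → (ℝ × E) [⋀^Fin (k + 1)]→L[ℝ] ℝ) (x : E) :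
    E [⋀^Fin k]→L[ℝ] ℝ :=
  ∫ t in (0 : ℝ)..1, contractTime E k (η (t, x))

theorem contDiff_fiberIntegral {η : ℝ × E → (ℝ × E) [⋀^Fin (k + 1)]→L[ℝ] ℝ}
    (hη : ContDiff ℝ ∞ η) : ContDiff ℝ ∞ (fiberIntegral η) :=
  contDiff_intervalIntegral ((contractTime E k).contDiff.comp hη) 0 1

theorem fiberIntegral_apply {η : ℝ × E → (ℝ × E) [⋀^Fin (k + 1)]→L[ℝ] ℝ}
    (hη : Continuous η) (x : E) (v : Fin k → E) :
    fiberIntegral η x v =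
      ∫ t in (0 : ℝ)..1, η (t, x) (Fin.cons (1, 0) fun i ↦ (0, v i)) :=
  ((ContinuousAlternatingMap.apply ℝ E ℝ v).intervalIntegral_comp_comm
    (((contractTime E k).continuous.comp
      (hη.comp (by fun_prop : Continuous fun t : ℝ ↦ (t, x)))).intervalIntegrable 0 1)).symm

/-- The fundamental theorem of calculus along the lines `ℝ × {x}`. -/
theorem integral_fderiv_time {η : ℝ × E → (ℝ × E) [⋀^Fin k]→L[ℝ] ℝ} (hη : ContDiff ℝ ∞ η)
    (x : E) (w : Fin k → ℝ × E) :
    ∫ t in (0 : ℝ)..1, fderiv ℝ η (t, x) (1, 0) w = η (1, x) w - η (0, x) w := by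
  refine integral_eq_sub_of_hasDerivAt (f := fun t ↦ η (t, x) w) (fun t _ ↦ ?_) ?_
  · have h := ((hη.differentiable (by simp)) (t, x)).hasFDerivAt.comp_hasDerivAt t
      ((hasDerivAt_id t).prodMk (hasDerivAt_const t x))
    exact (ContinuousAlternatingMap.apply ℝ (ℝ × E) ℝ w).hasFDerivAt.comp_hasDerivAt t h
  · have h : Continuous fun t : ℝ ↦ fderiv ℝ η (t, x) (1, 0) :=
      ((hη.continuous_fderiv (by simp)).comp
        (by fun_prop : Continuous fun t : ℝ ↦ (t, x))).clm_apply continuous_const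
    exact ((ContinuousAlternatingMap.apply ℝ (ℝ × E) ℝ w).continuous.comp h).intervalIntegrable 0 1

/-- The homotopy formula for closed forms on `ℝ × E`. -/
theorem extDeriv_fiberIntegral {η : ℝ × E → (ℝ × E) [⋀^Fin (k + 1)]→L[ℝ] ℝ}
    (hη : ContDiff ℝ ∞ η) (hd : extDeriv η = 0) (x : E) :
    extDeriv (fiberIntegral η) x =
      (η (1, x)).compContinuousLinearMap (ContinuousLinearMap.inr ℝ ℝ E) -
        (η (0, x)).compContinuousLinearMap (ContinuousLinearMap.inr ℝ ℝ E) := by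
  ext v
  set w : Fin (k + 1) → ℝ × E := fun i ↦ (0, v i) with hw
  -- Cartan's formula: in `dη = 0` evaluated on `∂/∂t` followed by `w`, the zeroth term is the time
  -- derivative and the others carry the opposite sign.
  have hcl (t : ℝ) : fderiv ℝ η (t, x) (1, 0) w =
      ∑ i, (-1) ^ i.val • fderiv ℝ η (t, x) (w i) (Fin.cons (1, 0) (i.removeNth w)) := by
    have h := congrArg (fun ξ ↦ ξ (Fin.cons (1, 0) w)) (congrFun hd (t, x))
    simp only [extDeriv, ContinuousAlternatingMap.alternatizeUncurryFin_apply, Pi.zero_apply,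
      ContinuousAlternatingMap.coe_zero, Fin.sum_univ_succ (n := k + 1)] at h
    simp only [Fin.val_zero, pow_zero, one_smul, Fin.cons_zero, Fin.val_succ, Fin.cons_succ,
      pow_succ, mul_neg, mul_one, neg_smul, Finset.sum_neg_distrib, Fin.removeNth_zero,
      Fin.tail_cons] at h
    rw [add_neg_eq_zero] at h
    rw [h]
    refine Finset.sum_congr rfl fun i _ ↦ ?_
    congr 2
    exact Fin.cons_comp_succ_succAbove _ _ _
  have hcont (i : Fin (k + 1)) : Continuous fun t : ℝ ↦
      fderiv ℝ η (t, x) (w i) (Fin.cons (1, 0) (i.removeNth w)) := by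
    have h : Continuous fun t : ℝ ↦ fderiv ℝ η (t, x) (w i) :=
      ((hη.continuous_fderiv (by simp)).comp
        (by fun_prop : Continuous fun t : ℝ ↦ (t, x))).clm_apply continuous_const
    exact (ContinuousAlternatingMap.apply ℝ (ℝ × E) ℝ _).continuous.comp h
  -- Differentiation passes under the integral, and the contraction, being linear and continuous,
  -- commutes with it.
  have hfd (i : Fin (k + 1)) : fderiv ℝ (fiberIntegral η) x (v i) (i.removeNth v) =
      ∫ t in (0 : ℝ)..1, fderiv ℝ η (t, x) (w i) (Fin.cons (1, 0) (i.removeNth w)) := by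
    have hsm := (contractTime E k).contDiff.comp hη (n := ∞)
    have hc : Continuous fun t : ℝ ↦ fderiv ℝ (contractTime E k ∘ η) (t, x) (0, v i) :=
      (((hsm.continuous_fderiv (by simp)).comp
        (by fun_prop : Continuous fun t : ℝ ↦ (t, x))).clm_apply continuous_const)
    have h1 := ((ContinuousAlternatingMap.apply ℝ E ℝ (i.removeNth v)).intervalIntegral_comp_comm
      (hc.intervalIntegrable (μ := volume) 0 1)).symm
    have h0 : fderiv ℝ (fiberIntegral η) x (v i) = _ :=
      fderiv_intervalIntegral_apply (hsm.of_le (by simp)) 0 1 x (v i)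
    rw [h0]
    refine h1.trans (integral_congr fun t _ ↦ ?_)
    have h2 : fderiv ℝ (contractTime E k ∘ η) (t, x) =
        (contractTime E k).comp (fderiv ℝ η (t, x)) :=
      ((contractTime E k).hasFDerivAt.comp _
        ((hη.differentiable (by simp)) (t, x)).hasFDerivAt).fderiv
    simp only [h2]
    rfl
  calc extDeriv (fiberIntegral η) x v
      = ∑ i, (-1) ^ i.val • fderiv ℝ (fiberIntegral η) x (v i) (i.removeNth v) :=
        ContinuousAlternatingMap.alternatizeUncurryFin_apply _ _
    _ = ∫ t in (0 : ℝ)..1, fderiv ℝ η (t, x) (1, 0) w := by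
        simp only [hfd, hcl, zsmul_eq_mul]
        refine Eq.trans (Finset.sum_congr rfl fun i _ ↦
          (intervalIntegral.integral_const_mul _ _).symm)
          (intervalIntegral.integral_finsetSum fun i _ ↦ ?_).symm
        exact Continuous.intervalIntegrable (continuous_const.mul (hcont i)) 0 1
    _ = _ := integral_fderiv_time hη x w

end FiberIntegral

/-! ### The homotopy operator on diffeological forms -/

section Homotopy

variable {X X' : Type*} [DiffeologicalSpace X] [DiffeologicalSpace X']

/-- An identification of the cylinder over `ℝⁿ` with `ℝⁿ⁺¹`. -/
noncomputable def cylinderEquiv (n : ℕ) :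
    (ℝ × EuclideanSpace ℝ (Fin n)) ≃L[ℝ] EuclideanSpace ℝ (Fin (n + 1)) :=
  -- Any linear isomorphism will do: `cylinderPlot` uses its inverse and `cylinderForm` pulls back
  -- along it, so the choice cancels.
  ContinuousLinearEquiv.ofFinrankEq (by simp [add_comm])

/-- The plot `(t, r) ↦ f_t (p r)` of `X` attached to a smooth path `f` of smooth maps `X' → X`
and a plot `p` of `X'`. -/
noncomputable def cylinderPlot {f : ℝ → SmoothMap X' X} (hf : DSmooth f) {n : ℕ}
    (p : {p : EuclideanSpace ℝ (Fin n) → X' // IsPlot p}) :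
    {p : EuclideanSpace ℝ (Fin (n + 1)) → X // IsPlot p} :=
  ⟨fun y ↦ f ((cylinderEquiv n).symm y).1 (p.1 ((cylinderEquiv n).symm y).2),
    -- Smoothness of `f` turns the time coordinate into a plot of the functional diffeology, that
    -- is, a smooth map on `ℝⁿ⁺¹ × X'`, which is then evaluated on the plot `y ↦ (y, p r)`.
    hf (n + 1) (fun y ↦ ((cylinderEquiv n).symm y).1)
      (contDiff_fst.comp (cylinderEquiv n).symm.contDiff).isPlot (n + 1)
      (fun y ↦ (y, p.1 ((cylinderEquiv n).symm y).2))
      ⟨isPlot_id', isPlot_reparam p.2 (contDiff_snd.comp (cylinderEquiv n).symm.contDiff)⟩⟩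

/-- The form `(t, r) ↦ α((t, r) ↦ f_t (p r))` on the cylinder over the domain of a plot `p`. -/
noncomputable def cylinderForm {f : ℝ → SmoothMap X' X} (hf : DSmooth f) {k : ℕ} (α : DForm X k)
    {n : ℕ} (p : {p : EuclideanSpace ℝ (Fin n) → X' // IsPlot p})
    (q : ℝ × EuclideanSpace ℝ (Fin n)) : (ℝ × EuclideanSpace ℝ (Fin n)) [⋀^Fin k]→L[ℝ] ℝ :=
  (α.1 (n + 1) (cylinderPlot hf p) (cylinderEquiv n q)).compContinuousLinearMap
    (cylinderEquiv n : (ℝ × EuclideanSpace ℝ (Fin n)) →L[ℝ] EuclideanSpace ℝ (Fin (n + 1)))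

variable {k : ℕ} {f : ℝ → SmoothMap X' X} (hf : DSmooth f)

theorem contDiff_cylinderForm (α : DForm X k) {n : ℕ}
    (p : {p : EuclideanSpace ℝ (Fin n) → X' // IsPlot p}) :
    ContDiff ℝ ∞ (cylinderForm hf α p) :=
  (ContinuousAlternatingMap.compContinuousLinearMapCLM
    (cylinderEquiv n : (ℝ × EuclideanSpace ℝ (Fin n)) →L[ℝ] EuclideanSpace ℝ (Fin (n + 1))) :
      (EuclideanSpace ℝ (Fin (n + 1)) [⋀^Fin k]→L[ℝ] ℝ) →L[ℝ] _).contDiff.comp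
    (((isDForm_val α).contDiff (n + 1) (cylinderPlot hf p)).comp (cylinderEquiv n).contDiff)

theorem extDeriv_cylinderForm (α : DForm X k) (hα : α ∈ closedForms X k) {n : ℕ}
    (p : {p : EuclideanSpace ℝ (Fin n) → X' // IsPlot p}) :
    extDeriv (cylinderForm hf α p) = 0 := by
  funext q
  have h := extDeriv_pullback (x := q) (r := ∞) (f := cylinderEquiv n)
    (((isDForm_val α).contDiff (n + 1) (cylinderPlot hf p)).differentiable (by simp) _)
    (cylinderEquiv n).contDiff.contDiffAt
    (by simpa using WithTop.coe_le_coe.2 (le_top : (2 : ℕ∞) ≤ ⊤))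
  simp only [ContinuousLinearEquiv.fderiv] at h
  have h0 : extDeriv (α.1 (n + 1) (cylinderPlot hf p)) = 0 :=
    congrFun (congrFun (congrArg Subtype.val (LinearMap.mem_ker.1 hα)) (n + 1)) _
  refine h.trans ?_
  rw [h0]
  ext
  simp

/-- Reparametrizing a plot by `F` pulls the form on the cylinder back along `id × F`. -/
theorem cylinderForm_comp (α : DForm X k) {m n : ℕ}
    (p : {p : EuclideanSpace ℝ (Fin n) → X' // IsPlot p})
    {F : EuclideanSpace ℝ (Fin m) → EuclideanSpace ℝ (Fin n)} (hF : ContDiff ℝ ∞ F) (t : ℝ)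
    (x : EuclideanSpace ℝ (Fin m)) :
    cylinderForm hf α ⟨p.1 ∘ F, isPlot_reparam p.2 hF⟩ (t, x) =
      (cylinderForm hf α p (t, F x)).compContinuousLinearMap
        ((ContinuousLinearMap.id ℝ ℝ).prodMap (fderiv ℝ F x)) := by
  -- `G` is `id × F` read in `ℝᵐ⁺¹` and `ℝⁿ⁺¹`, where the compatibility condition on `α` applies.
  set G : EuclideanSpace ℝ (Fin (m + 1)) → EuclideanSpace ℝ (Fin (n + 1)) :=
    cylinderEquiv n ∘ Prod.map id F ∘ (cylinderEquiv m).symm with hG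
  have hGs : ContDiff ℝ ∞ G :=
    (cylinderEquiv n).contDiff.comp ((contDiff_id.prodMap hF).comp (cylinderEquiv m).symm.contDiff)
  have hp : cylinderPlot hf ⟨p.1 ∘ F, isPlot_reparam p.2 hF⟩ =
      ⟨(cylinderPlot hf p).1 ∘ G, isPlot_reparam (cylinderPlot hf p).2 hGs⟩ := by
    refine Subtype.ext (funext fun y ↦ ?_)
    simp [cylinderPlot, hG]
  have hGd : fderiv ℝ G (cylinderEquiv m (t, x)) =
      (cylinderEquiv n : (ℝ × EuclideanSpace ℝ (Fin n)) →L[ℝ] _).comp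
        (((ContinuousLinearMap.id ℝ ℝ).prodMap (fderiv ℝ F x)).comp
          ((cylinderEquiv m).symm : _ →L[ℝ] (ℝ × EuclideanSpace ℝ (Fin m)))) := by
    refine HasFDerivAt.fderiv ((cylinderEquiv n).hasFDerivAt.comp _
      (HasFDerivAt.comp _ ?_ (cylinderEquiv m).symm.hasFDerivAt))
    rw [ContinuousLinearEquiv.symm_apply_apply]
    exact HasFDerivAt.prodMap (t, x) (hasFDerivAt_id t)
      ((hF.differentiable (by simp)) x).hasFDerivAt
  rw [cylinderForm, hp, (isDForm_val α).comp _ _ _ G hGs, hGd]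
  ext v
  simp [cylinderForm, hG, Function.comp_def]

/-- Restricting the form on the cylinder to time `t` gives the pullback by `f_t`. -/
theorem cylinderForm_restrict (α : DForm X k) {n : ℕ}
    (p : {p : EuclideanSpace ℝ (Fin n) → X' // IsPlot p})
    (t : ℝ) (x : EuclideanSpace ℝ (Fin n)) :
    (cylinderForm hf α p (t, x)).compContinuousLinearMap
      (ContinuousLinearMap.inr ℝ ℝ (EuclideanSpace ℝ (Fin n))) =
      ((f t).pullback α).1 n p x := by
  set G : EuclideanSpace ℝ (Fin n) → EuclideanSpace ℝ (Fin (n + 1)) :=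
    fun y ↦ cylinderEquiv n (t, y) with hG
  have hGs : ContDiff ℝ ∞ G := (cylinderEquiv n).contDiff.comp (contDiff_prodMk_right t)
  have hp : (⟨f t ∘ p.1, (f t).smooth n p.1 p.2⟩ : {p : _ → X // IsPlot p}) =
      ⟨(cylinderPlot hf p).1 ∘ G, isPlot_reparam (cylinderPlot hf p).2 hGs⟩ := by
    refine Subtype.ext (funext fun y ↦ ?_)
    simp [cylinderPlot, hG]
  have hGd : fderiv ℝ G x = (cylinderEquiv n : (ℝ × EuclideanSpace ℝ (Fin n)) →L[ℝ] _).comp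
      (ContinuousLinearMap.inr ℝ ℝ (EuclideanSpace ℝ (Fin n))) :=
    ((cylinderEquiv n).hasFDerivAt.comp x (hasFDerivAt_prodMk_right t x)).fderiv
  change _ = α.1 n ⟨f t ∘ p.1, (f t).smooth n p.1 p.2⟩ x
  rw [hp, (isDForm_val α).comp _ _ _ G hGs, hGd]
  rfl

/-- The chain homotopy operator `Ω^{k+1}(X) → Ω^k(X')` attached to a smooth path of smooth maps. -/
noncomputable def homotopyForm (α : DForm X (k + 1)) : DForm X' k :=
  ⟨fun _ p ↦ fiberIntegral (cylinderForm hf α p), by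
    refine IsDForm.mk (fun n p ↦ contDiff_fiberIntegral (contDiff_cylinderForm hf α p))
      fun m n p F hF x ↦ ?_
    ext v
    rw [ContinuousAlternatingMap.compContinuousLinearMap_apply,
      fiberIntegral_apply (contDiff_cylinderForm hf α _).continuous,
      fiberIntegral_apply (contDiff_cylinderForm hf α _).continuous]
    refine integral_congr fun t _ ↦ ?_
    simp only [cylinderForm_comp hf α p hF t x,
      ContinuousAlternatingMap.compContinuousLinearMap_apply]
    congr 1
    -- `id × dF` fixes `∂/∂t` and acts as `dF` on the spatial vectors.
    funext i
    refine Fin.cases ?_ (fun i ↦ ?_) i <;> simp⟩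

theorem extD_homotopyForm (α : DForm X (k + 1)) (hα : α ∈ closedForms X (k + 1)) :
    extD k (homotopyForm hf α) = (f 1).pullback α - (f 0).pullback α := by
  refine Subtype.ext (funext fun n ↦ funext fun p ↦ funext fun x ↦ ?_)
  refine (extDeriv_fiberIntegral (contDiff_cylinderForm hf α p)
    (extDeriv_cylinderForm hf α hα p) x).trans ?_
  rw [cylinderForm_restrict, cylinderForm_restrict]
  rfl

/-- A closed `0`-form has the same pullback along the ends of a smooth path of smooth maps. -/
theorem pullback_eq_of_closed_zero {f : ℝ → SmoothMap X' X} (hf : DSmooth f) (α : DForm X 0)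
    (hα : α ∈ closedForms X 0) :
    (f 1).pullback α = (f 0).pullback α := by
  refine Subtype.ext (funext fun n ↦ funext fun p ↦ funext fun x ↦ ?_)
  rw [← cylinderForm_restrict hf, ← cylinderForm_restrict hf]
  ext v
  have h := integral_fderiv_time (contDiff_cylinderForm hf α p) x fun i ↦ (0, v i)
  -- For a `0`-form, `dη` on the single vector `∂/∂t` is the time derivative of `η`.
  have h0 (t : ℝ) : fderiv ℝ (cylinderForm hf α p) (t, x) (1, 0) (fun i ↦ (0, v i)) = 0 := by
    have h := congrArg (fun ξ ↦ ξ (Fin.cons (1, 0) fun i ↦ (0, v i)))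
      (congrFun (extDeriv_cylinderForm hf α hα p) (t, x))
    simpa [extDeriv, ContinuousAlternatingMap.alternatizeUncurryFin_apply] using h
  simp only [h0, intervalIntegral.integral_zero] at h
  exact (sub_eq_zero.1 h.symm)

/-- No chain rule is needed: the pullback at `p` is `α` at the plot `g ∘ p`, where `dα` vanishes. -/
theorem pullback_mem_closedForms (g : SmoothMap X' X) {α : DForm X k}
    (hα : α ∈ closedForms X k) : g.pullback α ∈ closedForms X' k := by
  refine LinearMap.mem_ker.2 (Subtype.ext (funext fun n ↦ funext fun p ↦ ?_))
  exact congrFun (congrFun (congrArg Subtype.val (LinearMap.mem_ker.1 hα)) n) _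

end Homotopy

end Diffeology

open Diffeology
theorem mainTheorem1 {X X' : Type*} [DiffeologicalSpace X] [DiffeologicalSpace X']
    (f : ℝ → SmoothMap X' X) (hf : DSmooth f)
    (k : ℕ) (α : DForm X k) (hα : α ∈ closedForms X k) :
    Cohomologous ((f 1).pullback α) ((f 0).pullback α) := by
  refine ⟨pullback_mem_closedForms _ hα, pullback_mem_closedForms _ hα, ?_⟩
  cases k with
  | zero => exact (Submodule.mem_bot ℝ).2 (sub_eq_zero.2 (pullback_eq_of_closed_zero hf α hα))
  | succ k => exact ⟨homotopyForm hf α, extD_homotopyForm hf α hα⟩
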